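/- Let $n$ be a natural number. For $r>0$ let $\mathbf B(0,r)=\{x\in\mathbb R^n:|x|\le r\}$ be the Euclidean ball. There is a constant $C>0$, depending only on $n$, such that for every $n\times n$ matrix $A$ with integer entries and $|\det A|\ge 2$, the set $\mathbb Z^n\cap A^j(\mathbf B(0,r))$ is finite and $$\#\bigl|\mathbb Z^n\cap A^j(\mathbf B(0,r))\bigr|\le C\,\max(1,r^n)\,\max(1,|\det A|^j)\qquad\text{for all } j\in\mathbb Z,\ r>0.$$ Moreover, for every such $A$ there exists an $(A,\mathbb Z^n)$ wavelet set, that is, a measurable set $W\subset\mathbb R^n$ such that $$\sum_{j\in\mathbb Z}\mathbf 1_W(A^jx)=1\quad\text{and}\quad \sum_{\gamma\in\mathbb Z^n}\mathbf 1_W(x+\gamma)=1\qquad\text{for Lebesgue-almost every }x\in\mathbb R^n.$$ -/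

import Mathlib

open MeasureTheory
open scoped ENNReal

noncomputable section

/-- The linear map `x ↦ A ^ j x` of `ℝⁿ` given by an integer power of a square matrix `A`
(meaningful for all `j : ℤ` when `A` is invertible). -/
def dilate {n : ℕ} (A : Matrix (Fin n) (Fin n) ℝ) (j : ℤ) :
    EuclideanSpace ℝ (Fin n) →ₗ[ℝ] EuclideanSpace ℝ (Fin n) :=
  Matrix.toEuclideanLin (A ^ j)

/-- `∑_{j ∈ ℤ} 1_U (A ^ j x)`, as an element of `[0, ∞]`. -/
def dilationCount {n : ℕ} (A : Matrix (Fin n) (Fin n) ℝ) (U : Set (EuclideanSpace ℝ (Fin n)))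
    (x : EuclideanSpace ℝ (Fin n)) : ℝ≥0∞ :=
  ∑' j : ℤ, U.indicator (fun _ => (1 : ℝ≥0∞)) (dilate A j x)

/-- `∑_{γ ∈ Γ} 1_V (x + γ)`, as an element of `[0, ∞]`. -/
def translationCount {n : ℕ} (Γ : AddSubgroup (EuclideanSpace ℝ (Fin n)))
    (V : Set (EuclideanSpace ℝ (Fin n))) (x : EuclideanSpace ℝ (Fin n)) : ℝ≥0∞ :=
  ∑' γ : Γ, V.indicator (fun _ => (1 : ℝ≥0∞)) (x + (γ : EuclideanSpace ℝ (Fin n)))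

/-- `U` tiles `ℝⁿ` by `A` dilations: for Lebesgue almost every `x`, the sum
`∑_{j ∈ ℤ} 1_U (A ^ j x)` is at most one (packing) and at least one (covering). -/
def TilesByDilations {n : ℕ} (A : Matrix (Fin n) (Fin n) ℝ)
    (U : Set (EuclideanSpace ℝ (Fin n))) : Prop :=
  (∀ᵐ x ∂volume, dilationCount A U x ≤ 1) ∧ (∀ᵐ x ∂volume, 1 ≤ dilationCount A U x)

/-- `V` tiles `ℝⁿ` by `Γ` translations: for Lebesgue almost every `x`, the sum
`∑_{γ ∈ Γ} 1_V (x + γ)` is at most one (packing) and at least one (covering). -/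
def TilesByTranslations {n : ℕ} (Γ : AddSubgroup (EuclideanSpace ℝ (Fin n)))
    (V : Set (EuclideanSpace ℝ (Fin n))) : Prop :=
  (∀ᵐ x ∂volume, translationCount Γ V x ≤ 1) ∧ (∀ᵐ x ∂volume, 1 ≤ translationCount Γ V x)

/-- `W` is an `(A, Γ)` wavelet set, for an invertible matrix `A` and a full rank lattice `Γ`. -/
structure IsWaveletSet {n : ℕ} (A : Matrix (Fin n) (Fin n) ℝ)
    (Γ : AddSubgroup (EuclideanSpace ℝ (Fin n))) (W : Set (EuclideanSpace ℝ (Fin n))) : Prop where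
  measurableSet : MeasurableSet W
  tilesByDilations : TilesByDilations A W
  tilesByTranslations : TilesByTranslations Γ W

/-- The lattice `ℤⁿ` in `ℝⁿ`: the points all of whose coordinates are integers. -/
def integerLattice (n : ℕ) : AddSubgroup (EuclideanSpace ℝ (Fin n)) where
  carrier := {x | ∀ i, ∃ k : ℤ, x i = (k : ℝ)}
  zero_mem' := fun _ => ⟨0, by simp⟩
  add_mem' := by
    intro x y hx hy i
    obtain ⟨k, hk⟩ := hx i
    obtain ⟨l, hl⟩ := hy i
    exact ⟨k + l, by simp [hk, hl]⟩
  neg_mem' := by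
    intro x hx i
    obtain ⟨k, hk⟩ := hx i
    exact ⟨-k, by simp [hk]⟩

/-- The real matrix with the same entries as the integer matrix `A`. -/
def realMatrix {n : ℕ} (A : Matrix (Fin n) (Fin n) ℤ) : Matrix (Fin n) (Fin n) ℝ :=
  A.map (fun a : ℤ => (a : ℝ))

/-- The set `ℤⁿ ∩ A ^ j (B(0, r))`, with `B(0, r)` the closed Euclidean ball. -/
def latticePoints {n : ℕ} (A : Matrix (Fin n) (Fin n) ℤ) (j : ℤ) (r : ℝ) :
    Set (EuclideanSpace ℝ (Fin n)) :=
  (integerLattice n : Set (EuclideanSpace ℝ (Fin n))) ∩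
    dilate (realMatrix A) j '' Metric.closedBall 0 r

end

/-! Counting: for `j = k ≥ 0`, two points of the set congruent modulo `A ^ k ℤⁿ` differ by `A ^ k
w`, with `w` an integer vector of norm at most `2r`, and there are `|det A| ^ k` classes. For `j =
-k`, `A ^ k` maps the set injectively into the integer points of the ball.

Wavelet sets (the counting bound is not needed): as `|det A| > 1`, some left eigenvector `v` of `A`
has an eigenvalue `c` with `|c| > 1`, so `|∑ vᵢ xᵢ|` is multiplied by `|c|` at each dilation. Hence
the shell where it lies in `(|c|⁻¹, 1]` meets almost every dilation orbit exactly once, and a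
far-away unit cube, lying in one such shell up to scale, tiles by translations and packs by
dilations. A set with the two roles exchanged comes from `exists_dilation_transversal`: pieces of
the shell inside unit cubes are pulled back by powers of `A`. They still pack by translations,
because `A` maps `ℤⁿ` injectively into itself, and they shrink so fast that overlaps are negligible
by Borel–Cantelli. The Cantor–Bernstein argument `exists_common_transversal` merges the two sets. -/

open Filter

/-! ### Transversals for two countable group actions. -/

section Transversals

/-- Each orbit of `G` meets `S` at most once, and with trivial stabilizer. -/
def Packs (G : Type*) {X : Type*} [AddGroup G] [AddAction G X] (S : Set X) : Prop :=
  ∀ x ∈ S, ∀ g : G, g +ᵥ x ∈ S → g = 0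

/-- The union of the `G`-orbits that meet `S`. -/
def saturation (G : Type*) {X : Type*} [AddGroup G] [AddAction G X] (S : Set X) : Set X :=
  {x | ∃ g : G, g +ᵥ x ∈ S}

variable {G H X : Type*} [AddGroup G] [AddAction G X] [AddGroup H] [AddAction H X]

theorem Packs.mono {S T : Set X} (hT : Packs G T) (h : S ⊆ T) : Packs G S :=
  fun x hx g hg => hT x (h hx) g (h hg)

theorem subset_saturation (S : Set X) : S ⊆ saturation G S :=
  fun x hx => ⟨0, by simpa using hx⟩

theorem saturation_mono {S T : Set X} (h : S ⊆ T) : saturation G S ⊆ saturation G T :=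
  fun _ ⟨g, hg⟩ => ⟨g, h hg⟩

theorem vadd_mem_saturation_iff {S : Set X} (g : G) (x : X) :
    g +ᵥ x ∈ saturation G S ↔ x ∈ saturation G S := by
  constructor
  · rintro ⟨k, hk⟩
    exact ⟨k + g, by rwa [add_vadd]⟩
  · rintro ⟨k, hk⟩
    exact ⟨k - g, by rwa [vadd_vadd, sub_add_cancel]⟩

theorem saturation_eq_iUnion (S : Set X) :
    saturation G S = ⋃ g : G, (fun x => g +ᵥ x) ⁻¹' S := by
  ext x
  simp [saturation]

theorem MeasurableSet.saturation [MeasurableSpace X] [Countable G] [MeasurableConstVAdd G X]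
    {S : Set X} (hS : MeasurableSet S) : MeasurableSet (saturation G S) := by
  rw [saturation_eq_iUnion]
  exact MeasurableSet.iUnion fun g => measurable_const_vadd g hS

/-- The union of two packing sets with disjoint saturations is packing. -/
theorem Packs.union {S T : Set X} (hS : Packs G S) (hT : Packs G T)
    (h : Disjoint (saturation G S) T) : Packs G (S ∪ T) := by
  rintro x (hx | hx) g (hg | hg)
  · exact hS x hx g hg
  · exact absurd hg (Set.disjoint_left.1 h ((vadd_mem_saturation_iff g x).2 (subset_saturation S hx)))
  · exact absurd hx (Set.disjoint_left.1 h ⟨g, hg⟩)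
  · exact hT x hx g hg

theorem Packs.iUnion {S : ℕ → Set X} (hS : ∀ m, Packs G (S m))
    (h : ∀ l m, l < m → Disjoint (saturation G (S l)) (S m)) : Packs G (⋃ m, S m) := by
  intro x hx g hg
  obtain ⟨l, hl⟩ := Set.mem_iUnion.1 hx
  obtain ⟨m, hm⟩ := Set.mem_iUnion.1 hg
  rcases lt_trichotomy l m with hlm | rfl | hlm
  · exact absurd hm (Set.disjoint_left.1 (h l m hlm)
      ((vadd_mem_saturation_iff g x).2 (subset_saturation _ hl)))
  · exact hS l x hl g hm
  · exact absurd hl (Set.disjoint_left.1 (h m l hlm) ⟨g, hm⟩)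

/-- A measurable Cantor–Bernstein theorem: a transversal of the `G`-orbits that packs for `H` and
a transversal of the `H`-orbits that packs for `G` yield a common transversal. -/
theorem exists_common_transversal [MeasurableSpace X] [Countable G] [Countable H]
    [MeasurableConstVAdd G X] [MeasurableConstVAdd H X] {μ : Measure X} {U V : Set X}
    (hU : MeasurableSet U) (hV : MeasurableSet V)
    (hUG : Packs G U) (hUH : Packs H U) (hVG : Packs G V) (hVH : Packs H V)
    (hUcov : ∀ᵐ x ∂μ, x ∈ saturation G U) (hVcov : ∀ x, x ∈ saturation H V) :
    ∃ W : Set X, MeasurableSet W ∧ Packs G W ∧ Packs H W ∧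
      (∀ᵐ x ∂μ, x ∈ saturation G W) ∧ ∀ x, x ∈ saturation H W := by
  -- Orbits of `G` missing `V` must be served by `U`. The points of `U` so used displace the
  -- `H`-equivalent points of `V`, whose `G`-orbits must then be served by `U` as well; `C` iterates
  -- this. Outside `⋃ k, C k`, `V` serves.
  let C : ℕ → Set X := fun k =>
    Nat.rec (saturation G V)ᶜ (fun _ S => saturation G (V ∩ saturation H (U ∩ S))) k
  have hC0 : C 0 = (saturation G V)ᶜ := rfl
  have hCs : ∀ k, C (k + 1) = saturation G (V ∩ saturation H (U ∩ C k)) := fun k => rfl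
  have hCm : ∀ k, MeasurableSet (C k) := by
    intro k
    induction k with
    | zero => rw [hC0]; exact hV.saturation.compl
    | succ k ih => rw [hCs]; exact (hV.inter (hU.inter ih).saturation).saturation
  have hCinv : ∀ k (g : G) x, g +ᵥ x ∈ C k ↔ x ∈ C k := by
    intro k g x
    cases k with
    | zero => rw [hC0, Set.mem_compl_iff, Set.mem_compl_iff, vadd_mem_saturation_iff]
    | succ k => rw [hCs, vadd_mem_saturation_iff]
  have hCsat : saturation G (U ∩ ⋃ k, C k) ⊆ ⋃ k, C k := by
    rintro x ⟨g, -, hg⟩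
    obtain ⟨k, hk⟩ := Set.mem_iUnion.1 hg
    exact Set.mem_iUnion.2 ⟨k, (hCinv k g x).1 hk⟩
  have hUC : MeasurableSet (U ∩ ⋃ k, C k) := hU.inter (MeasurableSet.iUnion hCm)
  -- A point of `V` is displaced exactly when its `G`-orbit is served by `U`. The backward direction
  -- needs `V` to pack for `G`: the displaced point in the orbit of `v` is `v` itself.
  have hstep : ∀ v ∈ V, v ∈ saturation H (U ∩ ⋃ k, C k) ↔ v ∈ ⋃ k, C k := by
    intro v hv
    constructor
    · rintro ⟨h, hhU, hhC⟩
      obtain ⟨k, hk⟩ := Set.mem_iUnion.1 hhC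
      exact Set.mem_iUnion.2 ⟨k + 1, subset_saturation _ ⟨hv, h, hhU, hk⟩⟩
    · intro hvC
      obtain ⟨k, hk⟩ := Set.mem_iUnion.1 hvC
      cases k with
      | zero => exact absurd (subset_saturation V hv) hk
      | succ k =>
        obtain ⟨g, hgV, hgs⟩ := hk
        obtain rfl := hVG v hv g hgV
        rw [zero_vadd] at hgs
        exact saturation_mono (Set.inter_subset_inter_right U (Set.subset_iUnion C k)) hgs
  refine ⟨(U ∩ ⋃ k, C k) ∪ (V \ saturation H (U ∩ ⋃ k, C k)), hUC.union (hV.diff hUC.saturation),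
    (hUG.mono Set.inter_subset_left).union (hVG.mono Set.sdiff_subset) ?_,
    (hUH.mono Set.inter_subset_left).union (hVH.mono Set.sdiff_subset) ?_, ?_, ?_⟩
  · rw [Set.disjoint_left]
    exact fun x hx hxV => hxV.2 ((hstep x hxV.1).2 (hCsat hx))
  · exact Set.disjoint_sdiff_right
  · filter_upwards [hUcov] with x ⟨g, hg⟩
    by_cases hx : x ∈ ⋃ k, C k
    · obtain ⟨k, hk⟩ := Set.mem_iUnion.1 hx
      exact ⟨g, Or.inl ⟨hg, Set.mem_iUnion.2 ⟨k, (hCinv k g x).2 hk⟩⟩⟩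
    · have h0 : x ∈ saturation G V := by
        by_contra h
        exact hx (Set.mem_iUnion.2 ⟨0, h⟩)
      obtain ⟨g', hg'⟩ := h0
      refine ⟨g', Or.inr ⟨hg', fun h => hx ?_⟩⟩
      obtain ⟨k, hk⟩ := Set.mem_iUnion.1 ((hstep _ hg').1 h)
      exact Set.mem_iUnion.2 ⟨k, (hCinv k g' x).1 hk⟩
  · intro x
    by_cases hx : x ∈ saturation H (U ∩ ⋃ k, C k)
    · exact saturation_mono Set.subset_union_left hx
    · obtain ⟨h, hh⟩ := hVcov x
      exact ⟨h, Or.inr ⟨hh, fun h' => hx ((vadd_mem_saturation_iff h x).1 h')⟩⟩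

/-- If the sets `Q m` pack for both actions, then giving priority to later sets one can glue them
to a set packing for both actions, that covers whenever the trimmed sets cover. -/
theorem exists_packing_transversal [MeasurableSpace X] [Countable G] [Countable H]
    [MeasurableConstVAdd G X] [MeasurableConstVAdd H X] {μ : Measure X} {Q : ℕ → Set X}
    (hQ : ∀ m, MeasurableSet (Q m)) (hQG : ∀ m, Packs G (Q m)) (hQH : ∀ m, Packs H (Q m))
    (hcov : ∀ᵐ x ∂μ, ∃ m, x ∈ saturation G (Q m \ ⋃ i, saturation H (Q (m + 1 + i)))) :
    ∃ U : Set X, MeasurableSet U ∧ Packs G U ∧ Packs H U ∧ ∀ᵐ x ∂μ, x ∈ saturation G U := by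
  set R : ℕ → Set X := fun m => Q m \ ⋃ i, saturation H (Q (m + 1 + i)) with hR
  have hRm : ∀ m, MeasurableSet (R m) := fun m =>
    (hQ m).diff (MeasurableSet.iUnion fun i => (hQ _).saturation)
  have hRQ : ∀ m, R m ⊆ Q m := fun m => Set.sdiff_subset
  -- Overlaps of `G`-orbits are settled the other way, in favour of the earliest piece: this loses
  -- no `G`-orbit and keeps the `H`-packing gained by trimming.
  set S : ℕ → Set X := fun m => R m \ ⋃ l : Fin m, saturation G (R l) with hS
  have hSR : ∀ m, S m ⊆ R m := fun m => Set.sdiff_subset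
  refine ⟨⋃ m, S m, MeasurableSet.iUnion fun m =>
    (hRm m).diff (MeasurableSet.iUnion fun l => (hRm l).saturation), ?_, ?_, ?_⟩
  · refine Packs.iUnion (fun m => (hQG m).mono ((hSR m).trans (hRQ m))) fun l m hlm => ?_
    rw [Set.disjoint_left]
    exact fun x hx hxm => hxm.2 (Set.mem_iUnion.2 ⟨⟨l, hlm⟩, saturation_mono (hSR l) hx⟩)
  · refine Packs.iUnion (fun m => (hQH m).mono ((hSR m).trans (hRQ m))) fun l m hlm => ?_
    rw [Set.disjoint_left]
    rintro x ⟨h, hh⟩ hxm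
    refine (hSR l hh).2 (Set.mem_iUnion.2 ⟨m - (l + 1), ?_⟩)
    rw [vadd_mem_saturation_iff, Nat.add_sub_cancel' hlm]
    exact subset_saturation _ (hRQ m (hSR m hxm))
  · filter_upwards [hcov] with x hx
    classical
    obtain ⟨g, hg⟩ := Nat.find_spec hx
    refine ⟨g, Set.mem_iUnion.2 ⟨Nat.find hx, hg, fun h => ?_⟩⟩
    obtain ⟨l, hl⟩ := Set.mem_iUnion.1 h
    exact Nat.find_min hx l.2 ((vadd_mem_saturation_iff g x).1 hl)

/-- Each part of `Q` that `h` carries into `S` is moved there without change of measure, and the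
moved parts are disjoint because `Q` packs. -/
theorem measure_inter_saturation_le [MeasurableSpace X] [Countable H] [MeasurableConstVAdd H X]
    {μ : Measure X} [VAddInvariantMeasure H X μ] {Q S : Set X} (hQ : MeasurableSet Q)
    (hS : MeasurableSet S) (hpack : Packs H Q) : μ (Q ∩ saturation H S) ≤ μ S := by
  have hm : ∀ h : H, MeasurableSet ((fun x => -h +ᵥ x) ⁻¹' Q ∩ S) := fun h =>
    (measurable_const_vadd (-h) hQ).inter hS
  calc μ (Q ∩ saturation H S) = μ (⋃ h : H, Q ∩ (fun x => h +ᵥ x) ⁻¹' S) := by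
        rw [saturation_eq_iUnion, Set.inter_iUnion]
    _ ≤ ∑' h : H, μ (Q ∩ (fun x => h +ᵥ x) ⁻¹' S) := measure_iUnion_le _
    _ = ∑' h : H, μ ((fun x => -h +ᵥ x) ⁻¹' Q ∩ S) := by
        refine tsum_congr fun h => ?_
        rw [← measure_preimage_vadd μ h ((fun x => -h +ᵥ x) ⁻¹' Q ∩ S)]
        congr 1
        ext x
        simp
    _ = μ (⋃ h : H, (fun x => -h +ᵥ x) ⁻¹' Q ∩ S) := by
        refine (measure_iUnion (fun h k hhk => ?_) hm).symm
        refine Set.disjoint_left.2 fun x hx hx' => hhk ?_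
        have := hpack _ hx.1 (-k + h) (by simpa [vadd_vadd] using hx'.1)
        exact (neg_add_eq_zero.1 this).symm
    _ ≤ μ S := measure_mono (Set.iUnion_subset fun h => Set.inter_subset_right)

theorem Packs.tsum_indicator_le_one {S : Set X} (hS : Packs G S) (x : X) :
    ∑' g : G, S.indicator (fun _ => (1 : ℝ≥0∞)) (g +ᵥ x) ≤ 1 := by
  by_cases h : ∃ g : G, g +ᵥ x ∈ S
  · obtain ⟨g, hg⟩ := h
    rw [tsum_eq_single g]
    · exact Set.indicator_le_self' (fun _ _ => zero_le) _
    · intro k hk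
      refine Set.indicator_of_notMem (fun hkS => hk ?_) _
      have := hS _ hg (k - g) (by rwa [vadd_vadd, sub_add_cancel])
      exact sub_eq_zero.1 this
  · push Not at h
    simp [h]

theorem one_le_tsum_indicator {S : Set X} {x : X} (hx : x ∈ saturation G S) :
    1 ≤ ∑' g : G, S.indicator (fun _ => (1 : ℝ≥0∞)) (g +ᵥ x) := by
  obtain ⟨g, hg⟩ := hx
  calc (1 : ℝ≥0∞) = S.indicator (fun _ => (1 : ℝ≥0∞)) (g +ᵥ x) := by simp [hg]
    _ ≤ _ := ENNReal.le_tsum g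

end Transversals

/-! ### Integer powers of a matrix as an action of `ℤ`. -/

section Dilations

variable {n : ℕ}

theorem Matrix.det_zpow_eq {K : Type*} [Field K] (A : Matrix (Fin n) (Fin n) K) (j : ℤ) :
    (A ^ j).det = A.det ^ j := by
  cases j with
  | ofNat k => simp
  | negSucc k => simp [zpow_negSucc, Matrix.det_nonsing_inv]

theorem dilate_zero (A : Matrix (Fin n) (Fin n) ℝ) (x : EuclideanSpace ℝ (Fin n)) :
    dilate A 0 x = x := by
  simp [dilate]

theorem dilate_add {A : Matrix (Fin n) (Fin n) ℝ} (hA : IsUnit A.det) (i j : ℤ)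
    (x : EuclideanSpace ℝ (Fin n)) : dilate A (i + j) x = dilate A i (dilate A j x) := by
  simp [dilate, Matrix.zpow_add hA, Matrix.toLpLin_mul_same]

theorem dilate_one (A : Matrix (Fin n) (Fin n) ℝ) (x : EuclideanSpace ℝ (Fin n)) :
    dilate A 1 x = Matrix.toEuclideanLin A x := by
  simp [dilate]

theorem dilate_neg_dilate {A : Matrix (Fin n) (Fin n) ℝ} (hA : IsUnit A.det) (j : ℤ)
    (x : EuclideanSpace ℝ (Fin n)) : dilate A (-j) (dilate A j x) = x := by
  rw [← dilate_add hA, neg_add_cancel, dilate_zero]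

theorem dilate_dilate_neg {A : Matrix (Fin n) (Fin n) ℝ} (hA : IsUnit A.det) (j : ℤ)
    (x : EuclideanSpace ℝ (Fin n)) : dilate A j (dilate A (-j) x) = x := by
  rw [← dilate_add hA, add_neg_cancel, dilate_zero]

/-- The action of `ℤ` on `ℝⁿ` by the powers of an invertible matrix. -/
@[reducible] noncomputable def dilationAction {A : Matrix (Fin n) (Fin n) ℝ} (hA : IsUnit A.det) :
    AddAction ℤ (EuclideanSpace ℝ (Fin n)) where
  vadd j x := dilate A j x
  zero_vadd := dilate_zero A
  add_vadd := dilate_add hA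

theorem continuous_dilate (A : Matrix (Fin n) (Fin n) ℝ) (j : ℤ) : Continuous (dilate A j) :=
  LinearMap.continuous_of_finiteDimensional _

theorem volume_preimage_dilate {A : Matrix (Fin n) (Fin n) ℝ} (hA : A.det ≠ 0) (j : ℤ)
    (S : Set (EuclideanSpace ℝ (Fin n))) :
    volume (dilate A j ⁻¹' S) = ENNReal.ofReal (|A.det| ^ (-j)) * volume S := by
  have hdet : LinearMap.det (dilate A j) = A.det ^ j := by
    rw [dilate, LinearMap.det_toLpLin, Matrix.det_zpow_eq]
  rw [Measure.addHaar_preimage_linearMap volume (by rw [hdet]; exact zpow_ne_zero j hA), hdet,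
    ← zpow_neg, abs_zpow]

end Dilations

/-! ### An expanding linear functional. -/

section Pairing

variable {n : ℕ}

/-- The complex valued linear functional `x ↦ ∑ i, v i * x i` on `ℝⁿ`. -/
def pairing (v : Fin n → ℂ) : EuclideanSpace ℝ (Fin n) →ₗ[ℝ] ℂ where
  toFun x := ∑ i, v i * (x i : ℂ)
  map_add' x y := by simp [mul_add, Finset.sum_add_distrib]
  map_smul' c x := by simp [Finset.mul_sum, mul_left_comm]

theorem pairing_apply (v : Fin n → ℂ) (x : EuclideanSpace ℝ (Fin n)) :
    pairing v x = ∑ i, v i * (x i : ℂ) := rfl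

theorem continuous_pairing (v : Fin n → ℂ) : Continuous (pairing v) :=
  LinearMap.continuous_of_finiteDimensional _

theorem pairing_single (v : Fin n → ℂ) (i : Fin n) (c : ℝ) :
    pairing v (EuclideanSpace.single i c) = v i * c := by
  rw [pairing_apply, Finset.sum_eq_single i] <;> simp +contextual

/-- A matrix whose determinant exceeds one in absolute value has a left eigenvector whose
eigenvalue exceeds one in absolute value. -/
theorem exists_expanding_pairing (A : Matrix (Fin n) (Fin n) ℝ) (hA : 1 < |A.det|) :
    ∃ (c : ℂ) (v : Fin n → ℂ), 1 < ‖c‖ ∧ v ≠ 0 ∧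
      ∀ x, pairing v (Matrix.toEuclideanLin A x) = c * pairing v x := by
  set B : Matrix (Fin n) (Fin n) ℂ := A.map Complex.ofReal with hB
  have hdet : B.det = (A.det : ℂ) := (RingHom.map_det Complex.ofRealHom A).symm
  -- The determinant is the product of the complex eigenvalues, so they cannot all lie in the unit
  -- disc.
  obtain ⟨c, hc, hc1⟩ : ∃ c ∈ B.charpoly.roots, 1 < ‖c‖ := by
    by_contra! h
    have hprod : ∀ s : Multiset ℂ, (∀ c ∈ s, ‖c‖ ≤ 1) → ‖s.prod‖ ≤ 1 := by
      intro s
      induction s using Multiset.induction_on with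
      | empty => simp
      | cons a s ih =>
        intro hs
        rw [Multiset.prod_cons, norm_mul]
        exact mul_le_one₀ (hs a (Multiset.mem_cons_self a s)) (norm_nonneg _)
          (ih fun c hc => hs c (Multiset.mem_cons_of_mem hc))
    have := hprod _ h
    rw [← Matrix.det_eq_prod_roots_charpoly, hdet, Complex.norm_real, Real.norm_eq_abs] at this
    exact absurd this (not_le.2 hA)
  have hroot : (Matrix.scalar (Fin n) c - B).det = 0 := by
    rw [← Matrix.eval_charpoly]
    exact Polynomial.isRoot_of_mem_roots hc
  obtain ⟨v, hv, hvB⟩ := Matrix.exists_vecMul_eq_zero_iff.2 hroot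
  have heig : Matrix.vecMul v B = c • v := by
    rw [Matrix.vecMul_sub, sub_eq_zero] at hvB
    rw [← hvB]
    ext i
    simp [mul_comm]
  refine ⟨c, v, hc1, hv, fun x => ?_⟩
  have h1 : ∀ y : EuclideanSpace ℝ (Fin n),
      pairing v y = v ⬝ᵥ fun i => (y i : ℂ) := fun y => rfl
  have h2 : (fun i => ((Matrix.toEuclideanLin A x i : ℝ) : ℂ)) =
      Matrix.mulVec B fun i => (x i : ℂ) := by
    ext i
    simp [hB, Matrix.mulVec, dotProduct]
  rw [h1, h1, h2, Matrix.dotProduct_mulVec, heig, smul_dotProduct, smul_eq_mul]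

theorem norm_pairing_dilate {A : Matrix (Fin n) (Fin n) ℝ} (hA : IsUnit A.det) {c : ℂ}
    (hc : 1 < ‖c‖) {v : Fin n → ℂ}
    (hv : ∀ x, pairing v (Matrix.toEuclideanLin A x) = c * pairing v x) (j : ℤ)
    (x : EuclideanSpace ℝ (Fin n)) :
    ‖pairing v (dilate A j x)‖ = ‖c‖ ^ j * ‖pairing v x‖ := by
  have h0 : ‖c‖ ≠ 0 := (zero_lt_one.trans hc).ne'
  have hstep : ∀ j : ℤ, ‖pairing v (dilate A (1 + j) x)‖ = ‖c‖ * ‖pairing v (dilate A j x)‖ := by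
    intro j
    rw [dilate_add hA, dilate_one, hv, norm_mul]
  induction j using Int.induction_on with
  | zero => simp [dilate_zero]
  | succ k ih => rw [add_comm, hstep, ih, zpow_one_add₀ h0, mul_assoc]
  | pred k ih =>
    have := hstep (-k - 1)
    rw [add_sub_cancel, ih] at this
    rw [zpow_sub_one₀ h0]
    field_simp
    rw [mul_comm, ← this]

/-- A positive power multiplies the norm by at least `‖c‖`, whereas two values in the half-open
range have ratio less than `‖c‖`. -/
theorem packs_of_norm_pairing {A : Matrix (Fin n) (Fin n) ℝ} (hA : IsUnit A.det) {c : ℂ}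
    (hc : 1 < ‖c‖) {v : Fin n → ℂ}
    (hv : ∀ x, pairing v (Matrix.toEuclideanLin A x) = c * pairing v x)
    {S : Set (EuclideanSpace ℝ (Fin n))} {a : ℝ}
    (hS : ∀ x ∈ S, a < ‖pairing v x‖ ∧ ‖pairing v x‖ ≤ ‖c‖ * a) :
    let _ := dilationAction hA
    Packs ℤ S := by
  intro _
  have key : ∀ x ∈ S, ∀ j : ℤ, 0 < j → j +ᵥ x ∉ S := by
    intro x hx j hj hjx
    have h1 : ‖pairing v (dilate A j x)‖ ≤ ‖c‖ * a := (hS _ hjx).2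
    rw [norm_pairing_dilate hA hc hv] at h1
    have h2 : ‖c‖ ≤ ‖c‖ ^ j := by
      simpa using zpow_le_zpow_right₀ hc.le (show (1 : ℤ) ≤ j by omega)
    have h3 := mul_le_mul_of_nonneg_right h2 (norm_nonneg (pairing v x))
    have h4 := mul_lt_mul_of_pos_left (hS x hx).1 (zero_lt_one.trans hc)
    linarith
  intro x hx j hj
  rcases lt_trichotomy j 0 with h | h | h
  · refine absurd ?_ (key _ hj (-j) (by omega))
    rwa [neg_vadd_vadd]
  · exact h
  · exact absurd hj (key x hx j h)

theorem ae_pairing_ne_zero {v : Fin n → ℂ} (hv : v ≠ 0) : ∀ᵐ x, pairing v x ≠ 0 := by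
  obtain ⟨i, hi⟩ := Function.ne_iff.1 hv
  have hker : LinearMap.ker (pairing v) ≠ ⊤ := by
    intro h
    have : EuclideanSpace.single i (1 : ℝ) ∈ LinearMap.ker (pairing v) := h ▸ Submodule.mem_top
    rw [LinearMap.mem_ker, pairing_single] at this
    exact hi (by simpa using this)
  have := Measure.addHaar_submodule volume _ hker
  rw [ae_iff]
  convert this using 2
  ext x
  simp

end Pairing

/-! ### Unit cubes and integer translations. -/

section Lattice

variable {n : ℕ}

/-- An integer vector, as a point of `ℝⁿ`. -/
def intVec (a : Fin n → ℤ) : EuclideanSpace ℝ (Fin n) := WithLp.toLp 2 fun i => (a i : ℝ)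

@[simp] theorem intVec_apply (a : Fin n → ℤ) (i : Fin n) : intVec a i = a i := rfl

theorem intVec_injective : Function.Injective (intVec (n := n)) := by
  intro a b h
  ext i
  have := congrArg (fun x : EuclideanSpace ℝ (Fin n) => x i) h
  simpa using this

theorem coe_integerLattice :
    (integerLattice n : Set (EuclideanSpace ℝ (Fin n))) = Set.range intVec := by
  ext x
  constructor
  · intro hx
    choose a ha using hx
    refine ⟨a, ?_⟩
    ext i
    simp [ha]
  · rintro ⟨a, rfl⟩ i
    exact ⟨a i, rfl⟩

theorem mem_integerLattice_iff {x : EuclideanSpace ℝ (Fin n)} :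
    x ∈ integerLattice n ↔ ∃ a, intVec a = x := by
  rw [← SetLike.mem_coe, coe_integerLattice, Set.mem_range]

instance countable_integerLattice : Countable (integerLattice n) := by
  have : (integerLattice n : Set (EuclideanSpace ℝ (Fin n))).Countable := by
    rw [coe_integerLattice]
    exact Set.countable_range _
  exact this.to_subtype

theorem det_realMatrix (A : Matrix (Fin n) (Fin n) ℤ) : (realMatrix A).det = (A.det : ℝ) :=
  (RingHom.map_det (Int.castRingHom ℝ) A).symm

theorem dilate_natCast_intVec (A : Matrix (Fin n) (Fin n) ℤ) (k : ℕ) (a : Fin n → ℤ) :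
    dilate (realMatrix A) k (intVec a) = intVec ((A ^ k).mulVec a) := by
  have hpow : realMatrix A ^ k = realMatrix (A ^ k) :=
    (map_pow (Int.castRingHom ℝ).mapMatrix A k).symm
  ext i
  rw [dilate, zpow_natCast, hpow]
  simp [realMatrix, intVec, Matrix.mulVec, dotProduct]

/-- The half-open unit cube of `ℝⁿ` with corner `a`. -/
def latticeCube (a : Fin n → ℤ) : Set (EuclideanSpace ℝ (Fin n)) := {x | ∀ i, ⌊x i⌋ = a i}

theorem latticeCube_eq_preimage (a : Fin n → ℤ) :
    latticeCube a = WithLp.ofLp ⁻¹'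
      (Set.univ.pi fun i => Set.Ico (a i : ℝ) (a i + 1) : Set (Fin n → ℝ)) := by
  ext x
  simp [latticeCube, Int.floor_eq_iff]

theorem measurableSet_latticeCube (a : Fin n → ℤ) : MeasurableSet (latticeCube a) := by
  rw [latticeCube_eq_preimage]
  exact (PiLp.volume_preserving_ofLp (Fin n)).measurable
    (MeasurableSet.univ_pi fun i => measurableSet_Ico)

theorem volume_latticeCube (a : Fin n → ℤ) : volume (latticeCube a) = 1 := by
  rw [latticeCube_eq_preimage, (PiLp.volume_preserving_ofLp (Fin n)).measure_preimage
    (MeasurableSet.univ_pi fun i => measurableSet_Ico).nullMeasurableSet, Real.volume_pi_Ico]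
  simp

theorem mem_saturation_latticeCube (a : Fin n → ℤ) (x : EuclideanSpace ℝ (Fin n)) :
    x ∈ saturation (integerLattice n) (latticeCube a) := by
  refine ⟨⟨intVec fun i => a i - ⌊x i⌋, mem_integerLattice_iff.2 ⟨_, rfl⟩⟩, fun i => ?_⟩
  rw [AddSubgroup.vadd_def, vadd_eq_add, PiLp.add_apply, intVec_apply, Int.floor_intCast_add]
  ring

/-- The preimage of a unit cube under an integer matrix contains no two points that differ by an
integer vector. -/
theorem packs_preimage_dilate_latticeCube {A : Matrix (Fin n) (Fin n) ℤ}
    (hA : IsUnit (realMatrix A).det) (k : ℕ) (a : Fin n → ℤ) :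
    Packs (integerLattice n) (dilate (realMatrix A) k ⁻¹' latticeCube a) := by
  rintro x hx ⟨γ, hγ⟩ hγx
  obtain ⟨b, rfl⟩ := mem_integerLattice_iff.1 hγ
  have hb : (A ^ k).mulVec b = 0 := by
    ext i
    have h1 := hx i
    have h2 := hγx i
    rw [AddSubgroup.vadd_def, vadd_eq_add, map_add, dilate_natCast_intVec, PiLp.add_apply,
      intVec_apply, Int.floor_intCast_add, h1] at h2
    simpa using h2
  have h0 : dilate (realMatrix A) k (intVec b) = 0 := by
    rw [dilate_natCast_intVec, hb]
    ext i
    simp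
  have := dilate_neg_dilate hA k (intVec b)
  rw [h0, map_zero] at this
  exact Subtype.ext this.symm

theorem packs_latticeCube (a : Fin n → ℤ) : Packs (integerLattice n) (latticeCube a) := by
  have h := packs_preimage_dilate_latticeCube (A := (1 : Matrix (Fin n) (Fin n) ℤ))
    (by rw [det_realMatrix]; simp) 0 a
  have hid : dilate (realMatrix (1 : Matrix (Fin n) (Fin n) ℤ)) ((0 : ℕ) : ℤ) ⁻¹' latticeCube a =
      latticeCube a := by
    ext x
    simp [dilate_zero]
  rwa [hid] at h

/-- Far away, unit cubes lie in thin shells of a nonzero linear functional. -/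
theorem exists_latticeCube_norm_pairing {v : Fin n → ℂ} (hv : v ≠ 0) {t : ℝ} (ht : 1 < t) :
    ∃ (a : Fin n → ℤ) (r : ℝ),
      ∀ x ∈ latticeCube a, r < ‖pairing v x‖ ∧ ‖pairing v x‖ ≤ t * r := by
  obtain ⟨i, hi⟩ := Function.ne_iff.1 hv
  have hi' : 0 < ‖v i‖ := norm_pos_iff.2 hi
  set s : ℝ := ∑ k, ‖v k‖ with hs
  -- On the cube with corner `M eᵢ` the norm stays within `s` of `M * ‖v i‖`. The bound on `M` says
  -- `M * ‖v i‖ + s < t * (M * ‖v i‖ - s - 1)`; the extra `1` makes the lower inequality strict.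
  obtain ⟨M, hM⟩ := exists_nat_gt ((s + t * (s + 1)) / (‖v i‖ * (t - 1)))
  rw [div_lt_iff₀ (mul_pos hi' (by linarith))] at hM
  refine ⟨Pi.single i M, M * ‖v i‖ - s - 1, fun x hx => ?_⟩
  have hnear : ‖pairing v x - pairing v (intVec (Pi.single i (M : ℤ)))‖ ≤ s := by
    rw [← map_sub, pairing_apply]
    refine (norm_sum_le _ _).trans (Finset.sum_le_sum fun k _ => ?_)
    rw [norm_mul, Complex.norm_real, Real.norm_eq_abs, PiLp.sub_apply, intVec_apply]
    refine mul_le_of_le_one_right (norm_nonneg _) ?_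
    rw [← hx k, Int.self_sub_floor, abs_of_nonneg (Int.fract_nonneg _)]
    exact (Int.fract_lt_one _).le
  have hcorner : ‖pairing v (intVec (Pi.single i (M : ℤ)))‖ = M * ‖v i‖ := by
    have : intVec (Pi.single i (M : ℤ)) = EuclideanSpace.single i (M : ℝ) := by
      ext k
      by_cases hk : k = i
      · subst hk; simp
      · simp [hk]
    rw [this, pairing_single, norm_mul, mul_comm]
    simp
  have h1 := (abs_le.1 ((abs_norm_sub_norm_le _ _).trans hnear))
  rw [hcorner] at h1
  constructor
  · linarith [h1.1]
  · nlinarith [h1.2]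

end Lattice

/-! ### Construction of the wavelet set. -/

section WaveletSet

variable {n : ℕ}

theorem exists_dilate_mem_shell {A : Matrix (Fin n) (Fin n) ℝ} (hA : IsUnit A.det) {c : ℂ}
    (hc : 1 < ‖c‖) {v : Fin n → ℂ}
    (hv : ∀ x, pairing v (Matrix.toEuclideanLin A x) = c * pairing v x)
    {x : EuclideanSpace ℝ (Fin n)} (hx : pairing v x ≠ 0) :
    ∃ j : ℤ, ‖c‖⁻¹ < ‖pairing v (dilate A j x)‖ ∧ ‖pairing v (dilate A j x)‖ ≤ 1 := by
  have hc0 : 0 < ‖c‖ := zero_lt_one.trans hc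
  obtain ⟨k, hk1, hk2⟩ := exists_mem_Ioc_zpow (norm_pos_iff.2 hx) hc
  refine ⟨-(k + 1), ?_, ?_⟩
  · rw [norm_pairing_dilate hA hc hv, ← zpow_neg_one]
    calc ‖c‖ ^ (-1 : ℤ) = ‖c‖ ^ (-(k + 1)) * ‖c‖ ^ k := by
          rw [← zpow_add₀ hc0.ne']; congr 1; ring
      _ < _ := mul_lt_mul_of_pos_left hk1 (zpow_pos hc0 _)
  · rw [norm_pairing_dilate hA hc hv]
    calc ‖c‖ ^ (-(k + 1)) * ‖pairing v x‖ ≤ ‖c‖ ^ (-(k + 1)) * ‖c‖ ^ (k + 1) := by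
          gcongr
      _ = 1 := by rw [← zpow_add₀ hc0.ne', neg_add_cancel, zpow_zero]

/-- For an integer matrix there is a set that meets almost every dilation orbit exactly once and
packs by integer translations. It is glued from pieces of a dilation fundamental domain, shrunk so
fast that removing the translates of all later pieces leaves almost every orbit covered. -/
theorem exists_dilation_transversal {A : Matrix (Fin n) (Fin n) ℤ}
    (hA : IsUnit (realMatrix A).det) (hdet : 2 ≤ |(realMatrix A).det|) {c : ℂ} (hc : 1 < ‖c‖)
    {v : Fin n → ℂ} (hv0 : v ≠ 0)
    (hv : ∀ x, pairing v (Matrix.toEuclideanLin (realMatrix A) x) = c * pairing v x) :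
    let _ := dilationAction hA
    ∃ U : Set (EuclideanSpace ℝ (Fin n)), MeasurableSet U ∧ Packs ℤ U ∧
      Packs (integerLattice n) U ∧ ∀ᵐ x, x ∈ saturation ℤ U := by
  intro _
  have hvadd : ∀ (j : ℤ) (x : EuclideanSpace ℝ (Fin n)), j +ᵥ x = dilate (realMatrix A) j x :=
    fun _ _ => rfl
  have : MeasurableConstVAdd ℤ (EuclideanSpace ℝ (Fin n)) :=
    ⟨fun j => (continuous_dilate (realMatrix A) j).measurable⟩
  have hc0 : 0 < ‖c‖ := zero_lt_one.trans hc
  set d : ℝ := |(realMatrix A).det| with hd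
  have hd0 : 0 < d := by linarith
  -- Every cube is visited infinitely often, so that discarding finitely many stages does no harm.
  obtain ⟨e, he⟩ := exists_surjective_nat (Fin n → ℤ)
  let s : ℕ → Fin n → ℤ := fun m => e m.unpair.1
  have hs : ∀ a, ∃ᶠ m in atTop, s m = a := by
    intro a
    obtain ⟨i, rfl⟩ := he a
    exact frequently_atTop.2 fun N => ⟨Nat.pair i N, Nat.right_le_pair i N, by simp [s]⟩
  -- Squares have growing gaps, which makes `d ^ (κ m - κ (m + 1 + i))` summable over both `m` and
  -- `i`.
  obtain ⟨κ, hκ⟩ : ∃ κ : ℕ → ℕ, ∀ m i, κ m + (m + i) ≤ κ (m + 1 + i) :=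
    ⟨fun m => m ^ 2, fun m i => by nlinarith [Nat.zero_le (m * i), Nat.zero_le (i * i)]⟩
  let D : Set (EuclideanSpace ℝ (Fin n)) := {x | ‖c‖⁻¹ < ‖pairing v x‖ ∧ ‖pairing v x‖ ≤ 1}
  have hDm : MeasurableSet D :=
    (measurableSet_lt measurable_const (continuous_pairing v).norm.measurable).inter
      (measurableSet_le (continuous_pairing v).norm.measurable measurable_const)
  have hDpack : Packs ℤ D := packs_of_norm_pairing hA hc hv (a := ‖c‖⁻¹) fun x hx => by
    rw [mul_inv_cancel₀ hc0.ne']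
    exact hx
  let Q : ℕ → Set (EuclideanSpace ℝ (Fin n)) := fun m =>
    dilate (realMatrix A) (κ m : ℤ) ⁻¹' (D ∩ latticeCube (s m))
  have hQm : ∀ m, MeasurableSet (Q m) := fun m =>
    (continuous_dilate _ _).measurable (hDm.inter (measurableSet_latticeCube _))
  have hQG : ∀ m, Packs ℤ (Q m) := by
    intro m x hx j hj
    refine hDpack _ hx.1 j ?_
    have h : dilate (realMatrix A) (κ m : ℤ) (dilate (realMatrix A) j x) ∈ D := hj.1
    rwa [← dilate_add hA, add_comm, dilate_add hA] at h
  have hQH : ∀ m, Packs (integerLattice n) (Q m) := fun m =>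
    (packs_preimage_dilate_latticeCube hA (κ m) (s m)).mono
      (Set.preimage_mono Set.inter_subset_right)
  have hQvol : ∀ m, volume (Q m) ≤ ENNReal.ofReal (d ^ (-(κ m : ℤ))) := by
    intro m
    calc volume (Q m) = ENNReal.ofReal (d ^ (-(κ m : ℤ))) *
          volume (D ∩ latticeCube (s m)) := volume_preimage_dilate hA.ne_zero _ _
      _ ≤ ENNReal.ofReal (d ^ (-(κ m : ℤ))) * 1 := by
          gcongr
          exact (measure_mono Set.inter_subset_right).trans (volume_latticeCube _).le
      _ = _ := mul_one _
  -- The part of `Q m` lost to later pieces, carried back by `A ^ κ m` to the original scale in `D`.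
  let T : ℕ → Set (EuclideanSpace ℝ (Fin n)) := fun m =>
    dilate (realMatrix A) (-(κ m : ℤ)) ⁻¹'
      (Q m ∩ ⋃ i, saturation (integerLattice n) (Q (m + 1 + i)))
  have hTvol : ∀ m, volume (T m) ≤ ∑' i : ℕ, (2⁻¹ : ℝ≥0∞) ^ m * 2⁻¹ ^ i := by
    intro m
    have hT : T m = ⋃ i, dilate (realMatrix A) (-(κ m : ℤ)) ⁻¹'
        (Q m ∩ saturation (integerLattice n) (Q (m + 1 + i))) := by
      simp only [T, Set.inter_iUnion, Set.preimage_iUnion]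
    rw [hT]
    refine (measure_iUnion_le _).trans (ENNReal.tsum_le_tsum fun i => ?_)
    rw [volume_preimage_dilate hA.ne_zero, neg_neg]
    calc ENNReal.ofReal (d ^ (κ m : ℤ)) *
          volume (Q m ∩ saturation (integerLattice n) (Q (m + 1 + i)))
        ≤ ENNReal.ofReal (d ^ (κ m : ℤ)) *
          ENNReal.ofReal (d ^ (-(κ (m + 1 + i) : ℤ))) := by
          gcongr
          exact (measure_inter_saturation_le (hQm m) (hQm _) (hQH m)).trans (hQvol _)
      _ = ENNReal.ofReal (d ^ ((κ m : ℤ) + -(κ (m + 1 + i) : ℤ))) := by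
          rw [← ENNReal.ofReal_mul (zpow_nonneg hd0.le _), zpow_add₀ hd0.ne']
      _ ≤ ENNReal.ofReal (2⁻¹ ^ (m + i)) := by
          refine ENNReal.ofReal_le_ofReal ?_
          calc d ^ ((κ m : ℤ) + -(κ (m + 1 + i) : ℤ))
              ≤ d ^ (-((m + i : ℕ) : ℤ)) := by
                refine zpow_le_zpow_right₀ (by linarith) ?_
                have := hκ m i
                omega
            _ = d⁻¹ ^ (m + i) := by rw [zpow_neg, zpow_natCast, inv_pow]
            _ ≤ 2⁻¹ ^ (m + i) := by gcongr
      _ = 2⁻¹ ^ m * 2⁻¹ ^ i := by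
          rw [ENNReal.ofReal_pow (by norm_num), ENNReal.ofReal_inv_of_pos (by norm_num), pow_add]
          simp
  have hTsum : ∑' m, volume (T m) ≠ ∞ := by
    refine ne_top_of_le_ne_top ?_ (ENNReal.tsum_le_tsum hTvol)
    simp only [ENNReal.tsum_mul_left, ENNReal.tsum_mul_right, ENNReal.tsum_geometric]
    simp [ENNReal.mul_eq_top]
  -- Borel–Cantelli, applied to all dilates of `x` at once since dilations preserve null sets.
  have hae : ∀ᵐ x : EuclideanSpace ℝ (Fin n), ∀ j : ℤ,
      ∀ᶠ m in atTop, dilate (realMatrix A) j x ∉ T m := by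
    refine ae_all_iff.2 fun j => ?_
    have h := ae_eventually_notMem hTsum
    rw [ae_iff] at h ⊢
    have := volume_preimage_dilate hA.ne_zero j
      {x | ¬ ∀ᶠ m in atTop, x ∉ T m}
    rwa [h, mul_zero] at this
  refine exists_packing_transversal hQm hQG hQH ?_
  filter_upwards [hae, ae_pairing_ne_zero hv0] with x hx hx0
  obtain ⟨k, hy⟩ := exists_dilate_mem_shell hA hc hv hx0
  set y := dilate (realMatrix A) k x with hyx
  -- The cube of `y` recurs infinitely often while `y` lies in only finitely many `T m`, so some
  -- stage keeps the copy of `y`.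
  obtain ⟨m, hm, hmT⟩ := ((hs fun i => ⌊y i⌋).and_eventually (hx k)).exists
  have hyQ : dilate (realMatrix A) (-(κ m : ℤ)) y ∈ Q m := by
    refine Set.mem_preimage.2 ?_
    rw [dilate_dilate_neg hA]
    exact ⟨hy, fun i => (congrFun hm i).symm⟩
  refine ⟨m, -(κ m : ℤ) + k, ?_⟩
  rw [hvadd, dilate_add hA]
  exact ⟨hyQ, fun h => hmT ⟨hyQ, h⟩⟩

theorem exists_isWaveletSet (A : Matrix (Fin n) (Fin n) ℤ) (hA : 2 ≤ |A.det|) :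
    ∃ W : Set (EuclideanSpace ℝ (Fin n)),
      IsWaveletSet (realMatrix A) (integerLattice n) W := by
  have hdet : 2 ≤ |(realMatrix A).det| := by
    rw [det_realMatrix]
    exact_mod_cast hA
  have hunit : IsUnit (realMatrix A).det := by
    refine isUnit_iff_ne_zero.2 fun h => ?_
    rw [h, abs_zero] at hdet
    linarith
  obtain ⟨c, v, hc, hv0, hv⟩ := exists_expanding_pairing (realMatrix A) (by linarith)
  let _ := dilationAction hunit
  have : MeasurableConstVAdd ℤ (EuclideanSpace ℝ (Fin n)) :=
    ⟨fun j => (continuous_dilate (realMatrix A) j).measurable⟩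
  obtain ⟨U, hUm, hUG, hUH, hUcov⟩ := exists_dilation_transversal hunit hdet hc hv0 hv
  obtain ⟨a, r, har⟩ := exists_latticeCube_norm_pairing hv0 hc
  obtain ⟨W, hWm, hWG, hWH, hWGcov, hWHcov⟩ := exists_common_transversal hUm
    (measurableSet_latticeCube a) hUG hUH (packs_of_norm_pairing hunit hc hv har)
    (packs_latticeCube a) hUcov (mem_saturation_latticeCube a)
  have hcount : ∀ x, translationCount (integerLattice n) W x =
      ∑' γ : integerLattice n, W.indicator (fun _ => (1 : ℝ≥0∞)) (γ +ᵥ x) := by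
    intro x
    refine tsum_congr fun γ => ?_
    rw [AddSubgroup.vadd_def, vadd_eq_add, add_comm]
  refine ⟨W, hWm, ⟨ae_of_all _ hWG.tsum_indicator_le_one, ?_⟩,
    ⟨ae_of_all _ fun x => ?_, ae_of_all _ fun x => ?_⟩⟩
  · filter_upwards [hWGcov] with x hx using one_le_tsum_indicator hx
  · rw [hcount]
    exact hWH.tsum_indicator_le_one x
  · rw [hcount]
    exact one_le_tsum_indicator (hWHcov x)

end WaveletSet

/-! ### Counting lattice points in dilated balls. -/

section LatticeCounting

variable {n : ℕ}

/-- The integer vectors with all entries at most `r` in absolute value. -/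
noncomputable def integerBox (n : ℕ) (r : ℝ) : Finset (Fin n → ℤ) :=
  Fintype.piFinset fun _ => Finset.Icc (-⌊r⌋) ⌊r⌋

theorem mem_integerBox_of_norm_le {z : Fin n → ℤ} {r : ℝ} (h : ‖intVec z‖ ≤ r) :
    z ∈ integerBox n r := by
  refine Fintype.mem_piFinset.2 fun i => ?_
  have hi : |(z i : ℝ)| ≤ r := (PiLp.norm_apply_le (intVec z) i).trans h
  rw [Finset.mem_Icc, ← abs_le, Int.le_floor]
  exact_mod_cast hi

theorem card_integerBox_le {r : ℝ} (hr : 0 ≤ r) :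
    ((integerBox n r).card : ℝ) ≤ (2 * r + 1) ^ n := by
  have h0 : 0 ≤ ⌊r⌋ := Int.floor_nonneg.2 hr
  rw [integerBox, Fintype.card_piFinset_const, Int.card_Icc, Nat.cast_pow]
  gcongr
  rw [← Int.cast_natCast, Int.toNat_of_nonneg (by omega)]
  push_cast
  linarith [Int.floor_le r]

theorem natCard_quotient_range_mulVecLin {B : Matrix (Fin n) (Fin n) ℤ} (hB : B.det ≠ 0) :
    Nat.card ((Fin n → ℤ) ⧸ LinearMap.range B.mulVecLin) = B.det.natAbs := by
  have hinj : Function.Injective B.mulVecLin := by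
    rw [← LinearMap.ker_eq_bot, LinearMap.ker_eq_bot']
    exact fun w hw => Matrix.eq_zero_of_mulVec_eq_zero hB hw
  rw [← Submodule.natAbs_det_equiv _ (LinearEquiv.ofInjective B.mulVecLin hinj),
    ← LinearMap.det_toLin' B]
  rfl

/-- If `S` is a set of integer vectors such that any two elements of `S` congruent modulo the image
of `B` differ by the image of an element of `F`, then `S` has at most `|det B| * #F` elements. -/
theorem finite_and_ncard_le_of_congruent {B : Matrix (Fin n) (Fin n) ℤ} (hB : B.det ≠ 0)
    {S : Set (Fin n → ℤ)} {F : Finset (Fin n → ℤ)}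
    (h : ∀ z ∈ S, ∀ z' ∈ S, ∀ w, B.mulVec w = z - z' → w ∈ F) :
    S.Finite ∧ S.ncard ≤ B.det.natAbs * F.card := by
  have hcard := natCard_quotient_range_mulVecLin hB
  have : Finite ((Fin n → ℤ) ⧸ LinearMap.range B.mulVecLin) :=
    Nat.finite_of_card_ne_zero (by rw [hcard]; exact Int.natAbs_ne_zero.2 hB)
  let p := (LinearMap.range B.mulVecLin).mkQ
  -- One base point in `S` per residue class; for classes missing `S` the condition is vacuous and
  -- `0` is a dummy value.
  have hrep : ∀ q, ∃ z₀, ∀ z ∈ S, p z = q → z₀ ∈ S ∧ p z₀ = q := by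
    intro q
    by_cases hq : ∃ z₀ ∈ S, p z₀ = q
    · obtain ⟨z₀, hz₀⟩ := hq
      exact ⟨z₀, fun _ _ _ => hz₀⟩
    · exact ⟨0, fun z hz hzq => absurd ⟨z, hz, hzq⟩ hq⟩
  choose rep hrep using hrep
  have hw : ∀ z, ∃ w, z ∈ S → B.mulVec w = z - rep (p z) := by
    intro z
    by_cases hz : z ∈ S
    · have : z - rep (p z) ∈ LinearMap.range B.mulVecLin := by
        rw [← Submodule.Quotient.eq]
        exact (hrep _ z hz rfl).2.symm
      obtain ⟨w, hw⟩ := this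
      exact ⟨w, fun _ => hw⟩
    · exact ⟨0, fun h => absurd h hz⟩
  choose w hw using hw
  have hmaps : Set.MapsTo (fun z => (p z, w z)) S (Set.univ ×ˢ (F : Set (Fin n → ℤ))) :=
    fun z hz => ⟨Set.mem_univ _, h z hz _ (hrep _ z hz rfl).1 _ (hw z hz)⟩
  have hinj : Set.InjOn (fun z => (p z, w z)) S := by
    intro z hz z' hz' hzz
    obtain ⟨h1, h2⟩ := Prod.mk.inj hzz
    have e1 := hw z hz
    have e2 := hw z' hz'
    rw [h1, h2, e2] at e1
    exact (sub_left_injective e1).symm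
  have hfin : (Set.univ ×ˢ (F : Set (Fin n → ℤ)) :
      Set (((Fin n → ℤ) ⧸ LinearMap.range B.mulVecLin) × (Fin n → ℤ))).Finite :=
    Set.finite_univ.prod F.finite_toSet
  refine ⟨Set.Finite.of_injOn hmaps hinj hfin, ?_⟩
  have := Set.ncard_le_ncard_of_injOn _ hmaps hinj hfin
  rwa [Set.ncard_prod, Set.ncard_univ, hcard, Set.ncard_coe_finset] at this

theorem latticePoints_eq_image (A : Matrix (Fin n) (Fin n) ℤ) (j : ℤ) (r : ℝ) :
    latticePoints A j r =
      intVec '' {z | intVec z ∈ dilate (realMatrix A) j '' Metric.closedBall 0 r} := by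
  rw [latticePoints, coe_integerLattice, Set.inter_comm]
  exact Set.image_preimage_eq_inter_range.symm

theorem latticePoints_finite_and_ncard_le {A : Matrix (Fin n) (Fin n) ℤ} (hA : A.det ≠ 0)
    (j : ℤ) {r : ℝ} (hr : 0 < r) :
    (latticePoints A j r).Finite ∧
      ((latticePoints A j r).ncard : ℝ) ≤ 5 ^ n * max 1 (r ^ n) * max 1 (|(A.det : ℝ)| ^ j) := by
  have hunit : IsUnit (realMatrix A).det := by
    rw [det_realMatrix]
    exact isUnit_iff_ne_zero.2 (by exact_mod_cast hA)
  -- A box of radius `2r` has at most `(4r + 1) ^ n` integer points, hence the constant `5 ^ n`.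
  have hpow : (2 * (2 * r) + 1) ^ n ≤ 5 ^ n * max 1 (r ^ n) := by
    rcases le_total r 1 with h | h
    · calc (2 * (2 * r) + 1) ^ n ≤ 5 ^ n := by gcongr; linarith
        _ ≤ _ := le_mul_of_one_le_right (by positivity) (le_max_left _ _)
    · calc (2 * (2 * r) + 1) ^ n ≤ (5 * r) ^ n := by gcongr; linarith
        _ = 5 ^ n * r ^ n := mul_pow _ _ _
        _ ≤ _ := by gcongr; exact le_max_right _ _
  rw [latticePoints_eq_image, Set.ncard_image_of_injective _ intVec_injective]
  set S := {z | intVec z ∈ dilate (realMatrix A) j '' Metric.closedBall 0 r} with hS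
  suffices h : S.Finite ∧ ∃ N : ℕ, S.ncard ≤ N * (integerBox n (2 * r)).card ∧
      (N : ℝ) ≤ max 1 (|(A.det : ℝ)| ^ j) by
    obtain ⟨hfin, N, hN, hNle⟩ := h
    refine ⟨hfin.image _, ?_⟩
    calc (S.ncard : ℝ) ≤ N * (integerBox n (2 * r)).card := by exact_mod_cast hN
      _ ≤ max 1 (|(A.det : ℝ)| ^ j) * (5 ^ n * max 1 (r ^ n)) := by
          gcongr
          exact (card_integerBox_le (by linarith)).trans hpow
      _ = _ := mul_comm _ _
  obtain ⟨k, rfl | rfl⟩ := Int.eq_nat_or_neg j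
  · have h := finite_and_ncard_le_of_congruent (B := A ^ k) (S := S)
      (F := integerBox n (2 * r)) (by rw [Matrix.det_pow]; exact pow_ne_zero k hA) (by
        rintro z ⟨x, hx, hxz⟩ z' ⟨x', hx', hxz'⟩ w hw
        refine mem_integerBox_of_norm_le ?_
        have hsub : intVec (z - z') = intVec z - intVec z' := by
          ext i
          simp
        have : intVec w = x - x' := by
          rw [← dilate_neg_dilate hunit k (intVec w), dilate_natCast_intVec, hw, hsub, ← hxz,
            ← hxz', ← map_sub, dilate_neg_dilate hunit]
        rw [this]
        rw [mem_closedBall_zero_iff] at hx hx'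
        linarith [norm_sub_le x x'])
    refine ⟨h.1, _, h.2, ?_⟩
    rw [Matrix.det_pow, Int.natAbs_pow, Nat.cast_pow, zpow_natCast, Nat.cast_natAbs, Int.cast_abs]
    exact le_max_right _ _
  -- Radius `r` would suffice here; `2 * r` lets both signs of `j` share one bound, now with `N =
  -- 1`.
  · have hmaps : Set.MapsTo (fun z => (A ^ k).mulVec z) S (integerBox n (2 * r)) := by
      rintro z ⟨x, hx, hxz⟩
      refine mem_integerBox_of_norm_le ?_
      rw [← dilate_natCast_intVec, ← hxz, dilate_dilate_neg hunit]
      rw [mem_closedBall_zero_iff] at hx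
      linarith
    have hinj : Set.InjOn (fun z => (A ^ k).mulVec z) S := by
      intro z _ z' _ hzz
      refine intVec_injective ?_
      rw [← dilate_neg_dilate hunit k (intVec z), ← dilate_neg_dilate hunit k (intVec z'),
        dilate_natCast_intVec, dilate_natCast_intVec]
      exact congrArg (fun u => dilate (realMatrix A) (-(k : ℤ)) (intVec u)) hzz
    refine ⟨Set.Finite.of_injOn hmaps hinj (Finset.finite_toSet _), 1, ?_, by simp⟩
    rw [one_mul, ← Set.ncard_coe_finset]
    exact Set.ncard_le_ncard_of_injOn _ hmaps hinj (Finset.finite_toSet _)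

end LatticeCounting

theorem theorem6p7 (n : ℕ) :
    (∃ C : ℝ, 0 < C ∧ ∀ A : Matrix (Fin n) (Fin n) ℤ, 2 ≤ |A.det| → ∀ (j : ℤ) (r : ℝ), 0 < r →
      (latticePoints A j r).Finite ∧
        ((latticePoints A j r).ncard : ℝ) ≤
          C * max 1 (r ^ n) * max 1 (|(A.det : ℝ)| ^ j)) ∧
    (∀ A : Matrix (Fin n) (Fin n) ℤ, 2 ≤ |A.det| →
      ∃ W : Set (EuclideanSpace ℝ (Fin n)), IsWaveletSet (realMatrix A) (integerLattice n) W) := by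
  refine ⟨⟨5 ^ n, by positivity, fun A hA j r hr => latticePoints_finite_and_ncard_le ?_ j hr⟩,
    exists_isWaveletSet⟩
  rintro h
  rw [h] at hA
  norm_num at hA
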